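/- Let $\mathcal B=(\mathcal G,\mathcal P,\iota)$ be a generalized Bayesian network over a finite set $\mathcal V$ of Boolean random variables: $\mathcal G=(\mathcal V,\mathcal E)$ is a directed graph, $\mathrm{Pre}(X)$ is the set of parents of $X$, and $\mathrm{Init}(\mathcal G)$ is the set of nodes without parents; $\mathcal P$ assigns to each non-initial node $X$ and each Boolean assignment $b$ of $\mathrm{Pre}(X)$ a distribution $\mathrm{Pr}(\cdot\mid b)$ over the values of $X$; and $\iota$ is an arbitrary joint distribution over the Boolean assignments of $\mathrm{Init}(\mathcal G)$. Assume that $\mathcal G$ is acyclic, and let $\mu$ be the distribution over the assignments of $\mathcal V$ given by \[ \mu(b)=\iota\bigl(b_{\mathrm{Init}(\mathcal G)}\bigr)\cdot\prod_{X\in\mathcal V\setminus\mathrm{Init}(\mathcal G)}\mathrm{Pr}\bigl(b_X\mid b_{\mathrm{Pre}(X)}\bigr). \] Let $\mathrm{Close}(\mathcal G)=\bigl(\mathcal V,\ \mathcal E\cup\{(A,B): A,B\in\mathrm{Init}(\mathcal G),\ A\neq B\}\bigr)$. Let $\mathcal X,\mathcal Y,\mathcal Z\subseteq\mathcal V$ be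 pairwise disjoint and suppose that $\mathcal X$ and $\mathcal Y$ are $d$-separated given $\mathcal Z$ in $\mathrm{Close}(\mathcal G)$, that is, every sequence $W_0,\dots,W_k$ of distinct nodes with $W_0\in\mathcal X$, $W_k\in\mathcal Y$ and, for each $i<k$, $W_i\to W_{i+1}$ or $W_i\leftarrow W_{i+1}$ in $\mathrm{Close}(\mathcal G)$, has an index $0<i<k$ such that, with edges taken in $\mathrm{Close}(\mathcal G)$, 1. $W_i\in\mathcal Z$ and one of $W_{i-1}\to W_i\to W_{i+1}$, $W_{i-1}\leftarrow W_i\leftarrow W_{i+1}$, $W_{i-1}\leftarrow W_i\to W_{i+1}$ holds, or 2. $W_{i-1}\to W_i\leftarrow W_{i+1}$ and no node reachable from $W_i$ (including $W_i$ itself) is in $\mathcal Z$. Then $\mathcal X$ and $\mathcal Y$ are independent given $\mathcal Z$ under $\mu$: for all assignments $a$ of $\mathcal X$, $b$ of $\mathcal Y$ and $c$ of $\mathcal Z$, either $\mu(a\mid b,c)=\mu(a\mid c)$ or $\mu(b,c)=0$. -/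

import Mathlib

namespace GenBN

/-! ### Assignments and distributions -/

/-- Boolean assignments over a set (type) of variables. -/
abbrev Asg (U : Type*) : Type _ := U → Bool

/-- The restriction of an assignment to a subset of the variables. -/
def restr {V : Type*} (U : Set V) (b : Asg V) : Asg U := fun X => b X.1

section Distributions

open scoped Classical

/-- Distributions over a finite set `S`: non-negative real functions on `S` with total sum one. -/
abbrev Dist (S : Type*) [Fintype S] : Type _ := stdSimplex ℝ S

/-- Full assignments that agree with the partial assignment `d` on `U`. -/
def cyl {V : Type*} {U : Set V} (d : Asg U) : Set (Asg V) :=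
  {b | restr U b = d}

/-- Probability of a set of assignments. -/
noncomputable def prob {V : Type*} [Fintype V] (μ : Dist (Asg V)) (φ : Set (Asg V)) : ℝ :=
  ∑ b with b ∈ φ, μ b

/-- Conditional probability of `φ` given `ψ`, meaningful when `prob μ ψ ≠ 0`. -/
noncomputable def condProb {V : Type*} [Fintype V] (μ : Dist (Asg V)) (φ ψ : Set (Asg V)) : ℝ :=
  prob μ (φ ∩ ψ) / prob μ ψ

/-- Triples of pairwise disjoint sets of variables. -/
def DisjointTriples (V : Type*) : Set (Set V × Set V × Set V) :=
  {t | Disjoint t.1 t.2.1 ∧ Disjoint t.1 t.2.2 ∧ Disjoint t.2.1 t.2.2}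

/-- The triples `(X, Y, Z)` of disjoint sets of variables such that `X` and `Y` are independent
under `μ` given `Z`. -/
def Indep {V : Type*} [Fintype V] (μ : Dist (Asg V)) : Set (Set V × Set V × Set V) :=
  {t | t ∈ DisjointTriples V ∧
    ∀ (a : Asg t.1) (b : Asg t.2.1) (c : Asg t.2.2),
      condProb μ (cyl a) (cyl b ∩ cyl c) = condProb μ (cyl a) (cyl c) ∨
        prob μ (cyl b ∩ cyl c) = 0}

end Distributions

/-! ### Directed graphs -/

/-- The parents of a node. -/
def pre {V : Type*} (G : Digraph V) (X : V) : Set V := {Y | G.Adj Y X}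

/-- The nodes reachable from `X`, including `X` itself. -/
def postStar {V : Type*} (G : Digraph V) (X : V) : Set V := {Y | Relation.ReflTransGen G.Adj X Y}

/-- The initial nodes, i.e. the nodes without parents. -/
def init {V : Type*} (G : Digraph V) : Set V := {X | pre G X = ∅}

/-- No directed cycles (in particular no self-loops). -/
def Acyclic {V : Type*} (G : Digraph V) : Prop := ∀ X, ¬ Relation.TransGen G.Adj X X

/-- The graph with all edges between distinct initial nodes added. -/
def close {V : Type*} (G : Digraph V) : Digraph V where
  Adj A B := G.Adj A B ∨ (A ∈ init G ∧ B ∈ init G ∧ A ≠ B)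

/-- `p` is the node sequence of a simple undirected path from `x` to `y`. -/
def IsSimplePath {V : Type*} (G : Digraph V) (x y : V) (p : List V) : Prop :=
  p.Nodup ∧ p.IsChain (fun u v => G.Adj u v ∨ G.Adj v u) ∧
    p.head? = some x ∧ p.getLast? = some y

/-- The path with node sequence `p` is blocked given `Z`: for some three consecutive nodes
`u, w, v` of `p`, either `w ∈ Z` is in a chain or fork, or `w` is in a collider and no node
reachable from `w` is in `Z`. -/
def Blocked {V : Type*} (G : Digraph V) (Z : Set V) (p : List V) : Prop :=
  ∃ u w v : V, [u, w, v] <:+: p ∧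
    ((((G.Adj u w ∧ G.Adj w v) ∨ (G.Adj w u ∧ G.Adj v w) ∨ (G.Adj w u ∧ G.Adj w v)) ∧ w ∈ Z) ∨
      ((G.Adj u w ∧ G.Adj v w) ∧ postStar G w ∩ Z = ∅))

/-- The triples `(X, Y, Z)` such that `X` and `Y` are d-separated given `Z`. -/
def dSep {V : Type*} (G : Digraph V) : Set (Set V × Set V × Set V) :=
  {t | ∀ x ∈ t.1, ∀ y ∈ t.2.1, ∀ p : List V, IsSimplePath G x y p → Blocked G t.2.2 p}

/-! ### Generalized Bayesian networks -/

section Networks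

open scoped Classical

/-- Generalized Bayesian networks over the finite set `V` of nodes. -/
structure GBN (V : Type*) [Fintype V] where
  /-- The directed graph, possibly with cycles. -/
  graph : Digraph V
  /-- The conditional probability tables of the non-initial nodes. -/
  cpt : (X : V) → X ∉ init graph → Asg (pre graph X) → Dist (Asg ({X} : Set V))
  /-- The joint distribution over the initial nodes. -/
  iota : Dist (Asg (init graph))

variable {V : Type*} [Fintype V]

/-- The value of the chain rule at a full assignment. -/
noncomputable def chainRule (B : GBN V) (b : Asg V) : ℝ :=
  B.iota (restr (init B.graph) b) *
    ∏ X : {X : V // X ∉ init B.graph},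
      B.cpt X.1 X.2 (restr (pre B.graph X.1) b) (restr ({X.1} : Set V) b)

/-- Summing out a sink: the normalized factor of a variable on which nothing else depends. -/
theorem two_mul_sum_mul (X : V) (g w : Asg V → ℝ)
    (hg : ∀ b x, g (Function.update b X x) = g b)
    (hw : ∀ b, w (Function.update b X true) + w (Function.update b X false) = 1) :
    2 * ∑ b, g b * w b = ∑ b, g b := by
  have hinv : Function.Involutive (fun b : Asg V => Function.update b X (!b X)) := by
    intro b; simp
  have h1 : ∑ b, g b * w b = ∑ b, g b * w (Function.update b X (!b X)) := by
    rw [← Equiv.sum_comp hinv.toPerm]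
    refine Finset.sum_congr rfl fun b _ => ?_
    simp [hg]
  rw [two_mul]
  nth_rewrite 2 [h1]
  rw [← Finset.sum_add_distrib]
  refine Finset.sum_congr rfl fun b _ => ?_
  rw [← mul_add]
  have h2 : w b + w (Function.update b X (!b X)) = 1 := by
    have h := hw b
    cases hb : b X
    · have : Function.update b X false = b := by rw [← hb]; simp
      rw [this] at h; simpa [add_comm] using h
    · have : Function.update b X true = b := by rw [← hb]; simp
      rw [this] at h; simpa using h
  rw [h2, mul_one]

/-- In an acyclic graph, every non-empty finite set of nodes has a sink. -/
theorem exists_sink {G : Digraph V} (hG : Acyclic G) {P : V → Prop} (S : Finset {X : V // P X})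
    (hS : S.Nonempty) : ∃ X ∈ S, ∀ Y ∈ S, ¬ G.Adj X.1 Y.1 := by
  have : Std.Irrefl (fun a b : V => Relation.TransGen G.Adj b a) := ⟨hG⟩
  have : IsTrans V (fun a b : V => Relation.TransGen G.Adj b a) :=
    ⟨fun _ _ _ h1 h2 => h2.trans h1⟩
  have hwf := Finite.wellFounded_of_trans_of_irrefl (fun a b : V => Relation.TransGen G.Adj b a)
  obtain ⟨X, hX, h⟩ := (InvImage.wf (fun X : {X : V // P X} => X.1) hwf).has_min {X | X ∈ S} hS
  exact ⟨X, hX, fun Y hY hXY => h Y hY (Relation.TransGen.single hXY)⟩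

/-- Partial chain-rule products have total weight as if every factor contributed one half. -/
theorem sum_partial (B : GBN V) (hB : Acyclic B.graph) (n : ℕ) :
    ∀ S : Finset {X : V // X ∉ init B.graph}, S.card = n →
      (2 : ℝ) ^ n * ∑ b : Asg V, B.iota (restr (init B.graph) b) *
        ∏ X ∈ S, B.cpt X.1 X.2 (restr (pre B.graph X.1) b) (restr ({X.1} : Set V) b) =
      ∑ b : Asg V, B.iota (restr (init B.graph) b) := by
  induction n with
  | zero =>
    intro S hS
    rw [Finset.card_eq_zero] at hS
    simp [hS]
  | succ n ih =>
    intro S hS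
    obtain ⟨X, hX, hsink⟩ := exists_sink hB S (Finset.card_pos.mp (by omega))
    rw [← ih (S.erase X) (by rw [Finset.card_erase_of_mem hX, hS]; rfl), pow_succ, mul_assoc]
    congr 1
    rw [← two_mul_sum_mul X.1
      (fun b => B.iota (restr (init B.graph) b) *
        ∏ Y ∈ S.erase X,
          B.cpt Y.1 Y.2 (restr (pre B.graph Y.1) b) (restr ({Y.1} : Set V) b))
      (fun b => B.cpt X.1 X.2 (restr (pre B.graph X.1) b) (restr ({X.1} : Set V) b))]
    · congr 1
      refine Finset.sum_congr rfl fun b _ => ?_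
      rw [← Finset.mul_prod_erase S _ hX]
      ring
    · intro b x
      have hr : ∀ U : Set V, X.1 ∉ U → restr U (Function.update b X.1 x) = restr U b := by
        intro U hU
        funext u
        have hu : u.1 ≠ X.1 := fun h => hU (h ▸ u.2)
        simp [restr, hu]
      rw [hr _ X.2]
      congr 1
      refine Finset.prod_congr rfl fun Y hY => ?_
      rw [Finset.mem_erase] at hY
      rw [hr _ (hsink Y hY.2), hr _ (fun h => hY.1 (Subtype.ext h.symm))]
    · intro b
      have hr : ∀ x, restr (pre B.graph X.1) (Function.update b X.1 x) =
          restr (pre B.graph X.1) b := by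
        intro x
        funext u
        have hu : u.1 ≠ X.1 := by
          intro h
          have h2 : B.graph.Adj u.1 X.1 := u.2
          rw [h] at h2
          exact hB X.1 (Relation.TransGen.single h2)
        simp [restr, hu]
      have hc : ∀ x, restr ({X.1} : Set V) (Function.update b X.1 x) = fun _ => x := by
        intro x
        funext u
        have hu : u.1 = X.1 := u.2
        simp [restr, hu]
      simp only [hr, hc]
      rw [← (B.cpt X.1 X.2 (restr (pre B.graph X.1) b)).2.2,
        ← Equiv.sum_comp (Equiv.funUnique ({X.1} : Set V) Bool).symm, Fintype.sum_bool]
      rfl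

/-- For acyclic networks the chain rule yields a distribution. -/
theorem chainRule_mem (B : GBN V) (hB : Acyclic B.graph) : chainRule B ∈ stdSimplex ℝ (Asg V) := by
  refine ⟨fun b => mul_nonneg (B.iota.2.1 _) (Finset.prod_nonneg fun X _ => (B.cpt _ _ _).2.1 _), ?_⟩
  have h := sum_partial B hB _ Finset.univ rfl
  have h2 : ∑ b : Asg V, B.iota (restr (init B.graph) b) =
      (2 : ℝ) ^ (Finset.univ : Finset {X : V // X ∉ init B.graph}).card := by
    rw [← Equiv.sum_comp (Equiv.piEquivPiSubtypeProd (· ∈ init B.graph) (fun _ => Bool)).symm,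
      Fintype.sum_prod_type]
    have hr : ∀ x y, restr (init B.graph)
        ((Equiv.piEquivPiSubtypeProd (· ∈ init B.graph) (fun _ => Bool)).symm (x, y)) = x := by
      intro x y
      funext u
      have hu : u.1 ∈ init B.graph := u.2
      simp [Equiv.piEquivPiSubtypeProd, restr, hu]
    simp only [hr, Finset.sum_const]
    rw [← Finset.smul_sum]
    have h3 : ∑ x, B.iota x = 1 := B.iota.2.2
    have h4 : (Finset.univ : Finset ({X : V // X ∉ init B.graph} → Bool)).card =
        2 ^ (Finset.univ : Finset {X : V // X ∉ init B.graph}).card := by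
      simp
    rw [h4, nsmul_eq_mul]
    push_cast
    erw [h3]
    rw [mul_one]
  rw [h2] at h
  exact mul_left_cancel₀ (by positivity) (h.trans (mul_one _).symm)

/-- The standard distribution of an acyclic network, given by the chain rule. -/
noncomputable def distBN (B : GBN V) (hB : Acyclic B.graph) : Dist (Asg V) :=
  ⟨chainRule B, chainRule_mem B hB⟩

end Networks

end GenBN

/-!
Adding a latent common parent of all initial nodes to `B.graph` represents the correlations between
the initial nodes by forks, so d-separation in `close B.graph` becomes d-separation in an acyclic
graph. There, let `C` be the set of nodes outside `Z` that are d-connected to `Y` given `Z`. The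
initial nodes all lie in `C ∪ Z` or all lie outside `C`, and the same holds for any ancestor of
`X ∪ Y ∪ Z` together with its parents. Hence the product of the chain-rule factors of the ancestors
of `X ∪ Y ∪ Z` splits into a function of `C ∪ Z` and a function of the complement of `C`, while
the other factors are summed out, sinks first. Exchanging the values on `C` of two assignments that
agree on `Z` then gives `μ(a, b, c) μ(c) = μ(a, c) μ(b, c)`.
-/

namespace GenBN

/-! ### Trails -/

section Trails

variable {V : Type*} {G : Digraph V} {Z : Set V}

theorem Acyclic.asymm (hG : Acyclic G) {u v : V} (h : G.Adj u v) : ¬ G.Adj v u :=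
  fun h' => hG u (.head h (.single h'))

/-- The ancestors of a set of nodes, including the set itself. -/
def ancestors (G : Digraph V) (Z : Set V) : Set V := {v | (postStar G v ∩ Z).Nonempty}

theorem subset_ancestors (G : Digraph V) (Z : Set V) : Z ⊆ ancestors G Z :=
  fun z hz => ⟨z, .refl, hz⟩

theorem mem_ancestors_of_adj {u v : V} (h : G.Adj u v) :
    v ∈ ancestors G Z → u ∈ ancestors G Z :=
  fun ⟨z, hvz, hz⟩ => ⟨z, .head h hvz, hz⟩

theorem ancestors_union (G : Digraph V) (X Y : Set V) :
    ancestors G (X ∪ Y) = ancestors G X ∪ ancestors G Y := by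
  ext v
  simp only [ancestors, Set.inter_union_distrib_left, Set.union_nonempty, Set.mem_union,
    Set.mem_ofPred_eq]

/-- The condition of `Blocked` at three given consecutive nodes of a path. -/
def BlockedAt (G : Digraph V) (Z : Set V) (u w v : V) : Prop :=
  (((G.Adj u w ∧ G.Adj w v) ∨ (G.Adj w u ∧ G.Adj v w) ∨ (G.Adj w u ∧ G.Adj w v)) ∧ w ∈ Z) ∨
    ((G.Adj u w ∧ G.Adj v w) ∧ postStar G w ∩ Z = ∅)

theorem BlockedAt.symm {u w v : V} (h : BlockedAt G Z u w v) : BlockedAt G Z v w u := by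
  unfold BlockedAt at *
  tauto

theorem blockedAt_of_adj_left {u w v : V} (hw : w ∈ Z) (hwu : G.Adj w u)
    (hwv : G.Adj w v ∨ G.Adj v w) : BlockedAt G Z u w v :=
  .inl ⟨.inr (hwv.elim (fun h => .inr ⟨hwu, h⟩) fun h => .inl ⟨hwu, h⟩), hw⟩

theorem blockedAt_of_adj_right {u w v : V} (hw : w ∈ Z) (huw : G.Adj u w ∨ G.Adj w u)
    (hwv : G.Adj w v) : BlockedAt G Z u w v :=
  (blockedAt_of_adj_left hw hwv huw.symm).symm

theorem mem_ancestors_of_not_blockedAt {u w v : V} (h : ¬ BlockedAt G Z u w v) (huw : G.Adj u w)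
    (hvw : G.Adj v w) : w ∈ ancestors G Z :=
  Set.nonempty_iff_ne_empty.2 fun he => h (.inr ⟨⟨huw, hvw⟩, he⟩)

theorem not_blockedAt_of_notMem {u w v : V} (hw : w ∉ Z) (hwZ : w ∈ ancestors G Z) :
    ¬ BlockedAt G Z u w v := by
  rintro (⟨-, h⟩ | ⟨-, h⟩)
  exacts [hw h, hwZ.ne_empty h]

theorem not_blockedAt_of_adj_left (hG : Acyclic G) {u w v : V} (hw : w ∉ Z) (hwu : G.Adj w u) :
    ¬ BlockedAt G Z u w v := by
  rintro (⟨-, h⟩ | ⟨⟨h, -⟩, -⟩)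
  exacts [hw h, hG.asymm hwu h]

theorem not_blockedAt_of_adj_right (hG : Acyclic G) {u w v : V} (hw : w ∉ Z) (hwv : G.Adj w v) :
    ¬ BlockedAt G Z u w v :=
  fun h => not_blockedAt_of_adj_left hG hw hwv h.symm

theorem not_blockedAt_of_collider (hG : Acyclic G) {u w v : V} (hwZ : w ∈ ancestors G Z)
    (huw : G.Adj u w) (hvw : G.Adj v w) : ¬ BlockedAt G Z u w v := by
  have hwu := hG.asymm huw
  have hwv := hG.asymm hvw
  rintro (⟨h, -⟩ | ⟨-, h⟩)
  exacts [by tauto, hwZ.ne_empty h]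

/-- Undirected paths, possibly with repeated nodes, that are not blocked given `Z`. -/
def IsOpenTrail (G : Digraph V) (Z : Set V) (p : List V) : Prop :=
  p.IsChain (fun u v => G.Adj u v ∨ G.Adj v u) ∧ ¬ Blocked G Z p

namespace IsOpenTrail

theorem of_isInfix {p q : List V} (h : IsOpenTrail G Z p) (hq : q <:+: p) : IsOpenTrail G Z q :=
  ⟨h.1.infix hq, fun ⟨u, w, v, hi, hb⟩ => h.2 ⟨u, w, v, hi.trans hq, hb⟩⟩

theorem of_append_right {p q : List V} (h : IsOpenTrail G Z (p ++ q)) : IsOpenTrail G Z q :=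
  h.of_isInfix (List.suffix_append p q).isInfix

theorem tail {u : V} {p : List V} (h : IsOpenTrail G Z (u :: p)) : IsOpenTrail G Z p :=
  h.of_append_right (p := [u])

theorem not_blockedAt {p : List V} (h : IsOpenTrail G Z p) {u w v : V} (hi : [u, w, v] <:+: p) :
    ¬ BlockedAt G Z u w v :=
  fun hb => h.2 ⟨u, w, v, hi, hb⟩

theorem nil : IsOpenTrail G Z [] :=
  ⟨.nil, fun ⟨_, _, _, hi, _⟩ => by simpa using hi.length_le⟩

theorem singleton (u : V) : IsOpenTrail G Z [u] :=
  ⟨.singleton u, fun ⟨_, _, _, hi, _⟩ => by simpa using hi.length_le⟩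

theorem cons {u w : V} {p : List V} (h : IsOpenTrail G Z (w :: p))
    (huw : G.Adj u w ∨ G.Adj w u) (ho : ∀ v ∈ p.head?, ¬ BlockedAt G Z u w v) :
    IsOpenTrail G Z (u :: w :: p) := by
  refine ⟨h.1.cons_cons huw, ?_⟩
  rintro ⟨a, b, c, hi, hb⟩
  rcases List.infix_cons_iff.1 hi with ⟨q, hq⟩ | hi
  · obtain ⟨rfl, rfl, rfl⟩ : a = u ∧ b = w ∧ c :: q = p := by simpa using hq
    exact ho c rfl hb
  · exact h.not_blockedAt hi hb

theorem adj {u w : V} {p : List V} (h : IsOpenTrail G Z (u :: w :: p)) :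
    G.Adj u w ∨ G.Adj w u :=
  (List.isChain_cons_cons.1 h.1).1

theorem not_blockedAt_head {u w v : V} {p : List V} (h : IsOpenTrail G Z (u :: w :: v :: p)) :
    ¬ BlockedAt G Z u w v :=
  h.not_blockedAt (List.prefix_append [u, w, v] p).isInfix

theorem of_isChain_adj (hG : Acyclic G) {u : V} {p : List V} (h : (u :: p).IsChain G.Adj)
    (hp : ∀ v ∈ p, v ∉ Z) : IsOpenTrail G Z (u :: p) := by
  induction p generalizing u with
  | nil => exact .singleton u
  | cons w p ih =>
    obtain ⟨huw, hwp⟩ := List.isChain_cons_cons.1 h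
    refine (ih hwp fun v hv => hp v (.tail _ hv)).cons (.inl huw) fun v hv => ?_
    exact not_blockedAt_of_adj_right hG (hp w (.head _)) (List.isChain_cons.1 hwp |>.1 v hv)

theorem mem_ancestors_or_transGen {u w y : V} {p : List V} (h : IsOpenTrail G Z (u :: w :: p))
    (huw : G.Adj u w) (hy : (w :: p).getLast? = some y) :
    u ∈ ancestors G Z ∨ Relation.TransGen G.Adj u y := by
  induction p generalizing u w with
  | nil =>
    obtain rfl : w = y := by simpa using hy
    exact .inr (.single huw)
  | cons v p ih =>
    by_cases hvw : G.Adj v w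
    · exact .inl (mem_ancestors_of_adj huw
        (mem_ancestors_of_not_blockedAt h.not_blockedAt_head huw hvw))
    · have hwv : G.Adj w v := h.tail.adj.resolve_right hvw
      rcases ih h.tail hwv (by simpa using hy) with hw | hw
      exacts [.inl (mem_ancestors_of_adj huw hw), .inr (.head huw hw)]

-- If the detour leaves a collider `t → w ← v` along an edge `w → r`, it cannot return to `w` as a
-- directed path, so it meets a collider below `w`, which has a descendant in `Z`.
theorem not_blockedAt_of_detour (hG : Acyclic G) {t w r s v : V} {p : List V}
    (hp : IsOpenTrail G Z (w :: r :: p)) (hpw : (r :: p).getLast? = some w)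
    (hsw : G.Adj s w ∨ G.Adj w s) (htwr : ¬ BlockedAt G Z t w r) (hswv : ¬ BlockedAt G Z s w v) :
    ¬ BlockedAt G Z t w v := by
  rintro (⟨⟨-, hwv⟩ | ⟨hwt, -⟩ | ⟨hwt, -⟩, hw⟩ | ⟨⟨htw, -⟩, hw⟩)
  · exact hswv (blockedAt_of_adj_right hw hsw hwv)
  · exact htwr (blockedAt_of_adj_left hw hwt hp.adj)
  · exact htwr (blockedAt_of_adj_left hw hwt hp.adj)
  · have hwZ : w ∉ ancestors G Z := Set.not_nonempty_iff_eq_empty.2 hw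
    rcases hp.adj with hwr | hrw
    · exact (hp.mem_ancestors_or_transGen hwr hpw).elim hwZ (hG w)
    · exact hwZ (mem_ancestors_of_not_blockedAt htwr htw hrw)

theorem remove_detour (hG : Acyclic G) {t w : V} {p q : List V}
    (h : IsOpenTrail G Z (t :: w :: (p ++ w :: q))) : IsOpenTrail G Z (t :: w :: q) := by
  refine (h.of_append_right (p := t :: w :: p)).cons h.adj fun v hv => ?_
  obtain ⟨q, rfl⟩ := List.head?_eq_some_iff.1 hv
  obtain ⟨r, p', hr⟩ : ∃ r p', p ++ [w] = r :: p' := List.exists_cons_of_ne_nil (by simp)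
  obtain ⟨p'', s, hs⟩ : ∃ p'' s, w :: p = p'' ++ [s] :=
    ⟨_, _, (List.dropLast_append_getLast (List.cons_ne_nil w p)).symm⟩
  have hstart : p ++ w :: v :: q = r :: (p' ++ v :: q) := by
    simpa using congrArg (· ++ v :: q) hr
  have hend : w :: (p ++ w :: v :: q) = p'' ++ s :: w :: v :: q := by
    simpa using congrArg (· ++ w :: v :: q) hs
  have htwr : ¬ BlockedAt G Z t w r := (hstart ▸ h).not_blockedAt_head
  have hswv : IsOpenTrail G Z (s :: w :: v :: q) := (hend ▸ h.tail).of_append_right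
  have hloop : IsOpenTrail G Z (w :: r :: p') :=
    (hstart ▸ h.tail).of_isInfix (List.prefix_append (w :: r :: p') (v :: q)).isInfix
  exact not_blockedAt_of_detour hG hloop (by simp [← hr]) hswv.adj htwr hswv.not_blockedAt_head

theorem exists_nodup (hG : Acyclic G) {w : V} {p : List V} (h : IsOpenTrail G Z (w :: p)) :
    ∃ q, (w :: q).Nodup ∧ IsOpenTrail G Z (w :: q) ∧ (w :: q).getLast? = (w :: p).getLast? := by
  suffices ∃ q, (w :: q).Nodup ∧ IsOpenTrail G Z (w :: q) ∧
      (w :: q).getLast? = (w :: p).getLast? ∧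
      ∀ t, IsOpenTrail G Z (t :: w :: p) → IsOpenTrail G Z (t :: w :: q) from
    this.imp fun _ ⟨hnd, hq, hlast, _⟩ => ⟨hnd, hq, hlast⟩
  induction p generalizing w with
  | nil => exact ⟨[], List.nodup_singleton w, h, rfl, fun _ => id⟩
  | cons r p ih =>
    obtain ⟨q, hnd, hq, hlast, hext⟩ := ih h.tail
    have hext' : ∀ t, IsOpenTrail G Z (t :: w :: r :: p) → IsOpenTrail G Z (t :: w :: r :: q) :=
      fun t ht => (hext w h).cons ht.adj fun v hv => by
        obtain rfl : r = v := by simpa using hv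
        exact ht.not_blockedAt_head
    by_cases hw : w ∈ r :: q
    · obtain ⟨q₁, q₂, hsplit⟩ := List.append_of_mem hw
      rw [hsplit] at hnd hq hext' hlast
      refine ⟨q₂, hnd.of_append_right, hq.of_append_right, ?_, fun t ht =>
        remove_detour hG (hext' t ht)⟩
      rw [List.getLast?_cons_cons, ← hlast]
      simp only [List.getLast?_append, List.getLast?_cons, Option.some_or]
    · exact ⟨r :: q, List.nodup_cons.2 ⟨hw, hnd⟩, hext w h, by simpa using hlast, hext'⟩

end IsOpenTrail

/-! ### d-connection -/

variable {X Y : Set V}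

/-- `v` is d-connected to `Y` given `Z`. Repeated nodes are allowed, so that trails can be
concatenated freely; in acyclic graphs `IsOpenTrail.exists_nodup` makes them simple. -/
def DConnected (G : Digraph V) (Z Y : Set V) (v : V) : Prop :=
  ∃ p, ∃ y ∈ Y, IsOpenTrail G Z (v :: p) ∧ (v :: p).getLast? = some y

theorem dConnected_of_mem {y : V} (hy : y ∈ Y) : DConnected G Z Y y :=
  ⟨[], y, hy, .singleton y, rfl⟩

theorem dConnected_of_adj_of_mem_ancestors (hG : Acyclic G) {u n : V} (hun : G.Adj u n)
    (hn : n ∈ ancestors G Y) (hnZ : n ∉ ancestors G Z) : DConnected G Z Y u := by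
  obtain ⟨y, hny, hy⟩ := hn
  obtain ⟨p, hp, hlast⟩ := List.exists_isChain_cons_of_relationReflTransGen hny
  have hpZ : ∀ v ∈ n :: p, v ∉ ancestors G Z :=
    hp.induction (· ∉ ancestors G Z) _ (fun _ _ h => mt (mem_ancestors_of_adj h)) fun _ => hnZ
  refine ⟨n :: p, y, hy, .of_isChain_adj hG (hp.cons_cons hun) fun v hv hvZ =>
    hpZ v hv (subset_ancestors G Z hvZ), ?_⟩
  rw [List.getLast?_cons_cons, List.getLast?_eq_some_getLast (List.cons_ne_nil n p), hlast]

namespace DConnected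

theorem of_adj {u v : V} (h : DConnected G Z Y v) (huv : G.Adj u v ∨ G.Adj v u)
    (ho : ∀ t, ¬ BlockedAt G Z u v t) : DConnected G Z Y u := by
  obtain ⟨p, y, hy, hp, hlast⟩ := h
  exact ⟨v :: p, y, hy, hp.cons huv fun t _ => ho t, by simpa using hlast⟩

theorem child (hG : Acyclic G) {v n : V} (h : DConnected G Z Y v) (hv : v ∉ Z)
    (hvn : G.Adj v n) : DConnected G Z Y n :=
  h.of_adj (.inr hvn) fun _ => not_blockedAt_of_adj_left hG hv hvn

theorem parent {u n : V} (h : DConnected G Z Y n) (hn : n ∉ Z) (hnZ : n ∈ ancestors G Z)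
    (hun : G.Adj u n) : DConnected G Z Y u :=
  h.of_adj (.inl hun) fun _ => not_blockedAt_of_notMem hn hnZ

theorem coparent (hG : Acyclic G) {u v n : V} (h : DConnected G Z Y v) (hv : v ∉ Z)
    (hnZ : n ∈ ancestors G Z) (hvn : G.Adj v n) (hun : G.Adj u n) : DConnected G Z Y u := by
  obtain ⟨p, y, hy, hp, hlast⟩ := h
  have hn : IsOpenTrail G Z (n :: v :: p) :=
    hp.cons (.inr hvn) fun _ _ => not_blockedAt_of_adj_left hG hv hvn
  refine ⟨n :: v :: p, y, hy, hn.cons (.inl hun) ?_, by simpa using hlast⟩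
  rintro _ ⟨⟩
  exact not_blockedAt_of_collider hG hnZ hun hvn

theorem exists_mem_of_mem_ancestors (hG : Acyclic G) {n : V} (h : DConnected G Z Y n)
    (hn : n ∈ ancestors G X) (hnZ : n ∉ ancestors G Z) : ∃ x ∈ X, DConnected G Z Y x := by
  obtain ⟨x, hnx, hx⟩ := hn
  induction hnx using Relation.ReflTransGen.head_induction_on with
  | refl => exact ⟨x, hx, h⟩
  | head hac _ ih =>
    exact ih (h.child hG (fun haZ => hnZ (subset_ancestors G Z haZ)) hac)
      fun hcZ => hnZ (mem_ancestors_of_adj hac hcZ)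

theorem parent_of_mem_ancestors_union (hG : Acyclic G) (hX : ∀ x ∈ X, ¬ DConnected G Z Y x)
    {u n : V} (h : DConnected G Z Y n) (hn : n ∉ Z) (hanc : n ∈ ancestors G (X ∪ Y ∪ Z))
    (hun : G.Adj u n) : DConnected G Z Y u := by
  by_cases hnZ : n ∈ ancestors G Z
  · exact h.parent hn hnZ hun
  · rw [ancestors_union, ancestors_union] at hanc
    rcases hanc with (hnX | hnY) | hnZ'
    · obtain ⟨x, hx, hxY⟩ := h.exists_mem_of_mem_ancestors hG hnX hnZ
      exact absurd hxY (hX x hx)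
    · exact dConnected_of_adj_of_mem_ancestors hG hun hnY hnZ
    · exact absurd hnZ' hnZ

end DConnected

theorem not_dConnected_of_dSep (hG : Acyclic G) (h : (X, Y, Z) ∈ dSep G) {x : V} (hx : x ∈ X) :
    ¬ DConnected G Z Y x := by
  rintro ⟨p, y, hy, hp, hlast⟩
  obtain ⟨q, hnd, hq, hqlast⟩ := hp.exists_nodup hG
  exact hq.2 (h x hx y hy (x :: q) ⟨hnd, hq.1, rfl, hqlast.trans hlast⟩)

/-- The `Y`-side of the cut that `Z` makes in the graph. -/
def dSide (G : Digraph V) (Z Y : Set V) : Set V := {v | v ∉ Z ∧ DConnected G Z Y v}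

/-- A function of the variables in `S` can be assigned to one side of the cut `(C, Z)`: it is a
function of the variables in `C ∪ Z`, or of the variables outside `C`. -/
def OneSided (C Z S : Set V) : Prop := (S ∩ C).Nonempty → S ⊆ C ∪ Z

theorem oneSided_dSide_of_forall {S : Set V}
    (h : ∀ s ∈ S, s ∉ Z → DConnected G Z Y s → ∀ t ∈ S, t ∉ Z → DConnected G Z Y t) :
    OneSided (dSide G Z Y) Z S :=
  fun ⟨s, hs, hsZ, hsY⟩ t ht => or_iff_not_imp_right.2 fun htZ => ⟨htZ, h s hs hsZ hsY t ht htZ⟩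

theorem oneSided_family (hG : Acyclic G) (hsep : (X, Y, Z) ∈ dSep G) {n : V}
    (hn : n ∈ ancestors G (X ∪ Y ∪ Z)) : OneSided (dSide G Z Y) Z (insert n (pre G n)) := by
  have hX : ∀ x ∈ X, ¬ DConnected G Z Y x := fun x hx => not_dConnected_of_dSep hG hsep hx
  refine oneSided_dSide_of_forall ?_
  rintro s (rfl | hsn) hsZ hs t (rfl | htn) -
  · exact hs
  · exact hs.parent_of_mem_ancestors_union hG hX hsZ hn htn
  · exact hs.child hG hsZ hsn
  · by_cases hnZ : n ∈ ancestors G Z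
    · exact hs.coparent hG hsZ hnZ hsn htn
    · exact (hs.child hG hsZ hsn).parent_of_mem_ancestors_union hG hX
        (fun h => hnZ (subset_ancestors G Z h)) hn htn

theorem DConnected.of_pre_eq_singleton (hG : Acyclic G) {i u : V} (h : DConnected G Z Y i)
    (hi : pre G i = {u}) (hiZ : i ∉ Z) : DConnected G Z Y u := by
  have hui : G.Adj u i := show u ∈ pre G i from hi ▸ rfl
  obtain ⟨p, y, hy, hp, hlast⟩ := h
  by_cases hpi : ∀ t ∈ p.head?, G.Adj i t
  · exact ⟨i :: p, y, hy, hp.cons (.inl hui) fun t ht =>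
      not_blockedAt_of_adj_right hG hiZ (hpi t ht), by simpa using hlast⟩
  · push Not at hpi
    obtain ⟨t, ht, hit⟩ := hpi
    obtain ⟨p, rfl⟩ := List.head?_eq_some_iff.1 ht
    obtain rfl : t = u := hi.subset (hp.adj.resolve_left hit)
    exact ⟨p, y, hy, hp.tail, by simpa using hlast⟩

theorem oneSided_setOf_pre_eq_singleton (hG : Acyclic G) {u : V} (hu : u ∉ Z) :
    OneSided (dSide G Z Y) Z {i | pre G i = {u}} :=
  oneSided_dSide_of_forall fun _ hi hiZ hiY j hj _ =>
    (hiY.of_pre_eq_singleton hG hi hiZ).child hG hu (show u ∈ pre G j from hj ▸ rfl)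

end Trails

/-! ### A latent common parent of the initial nodes -/

section Latent

variable {V : Type*} {G : Digraph V} {X Y Z : Set V}

/-- The graph with a new node `none` that is the parent of all initial nodes. It turns the
two-way edges that `close G` has between initial nodes into forks, so it is acyclic if `G` is. -/
def latent (G : Digraph V) : Digraph (Option V) where
  Adj
    | none, some v => v ∈ init G
    | some u, some v => G.Adj u v
    | _, none => False

theorem not_latent_adj_none : ∀ o : Option V, ¬ (latent G).Adj o none
  | none => id
  | some _ => id

theorem not_adj_of_mem_init {u v : V} (hv : v ∈ init G) : ¬ G.Adj u v :=
  fun h => (Set.eq_empty_iff_forall_notMem.1 hv) u h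

theorem preimage_some_setOf_pre_latent :
    some ⁻¹' {o | pre (latent G) o = {none}} = init G := by
  ext v
  refine ⟨fun h => Set.eq_empty_iff_forall_notMem.2 fun u huv => ?_, fun hv => ?_⟩
  · have hu : some u ∈ pre (latent G) (some v) := huv
    rw [show pre (latent G) (some v) = {none} from h] at hu
    simp at hu
  · ext (_ | u)
    · exact iff_of_true hv rfl
    · exact iff_of_false (not_adj_of_mem_init hv) (by simp)

theorem preimage_some_insert_pre_latent (v : V) :
    some ⁻¹' insert (some v) (pre (latent G) (some v)) = insert v (pre G v) := by
  ext u
  exact or_congr_left Option.some_inj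

theorem postStar_latent_some (u : V) : postStar (latent G) (some u) = some '' postStar G u := by
  ext o
  constructor
  · intro h
    induction h with
    | refl => exact ⟨u, .refl, rfl⟩
    | @tail _ o _ hvo ih =>
      obtain ⟨v, huv, rfl⟩ := ih
      cases o with
      | none => exact (not_latent_adj_none _ hvo).elim
      | some w => exact ⟨w, .tail huv hvo, rfl⟩
  · rintro ⟨v, huv, rfl⟩
    exact Relation.ReflTransGen.lift some (fun _ _ h => h) _ _ huv

theorem acyclic_latent (hG : Acyclic G) : Acyclic (latent G) := by
  rintro (_ | v) h
  · obtain ⟨_, _, h⟩ := Relation.TransGen.tail'_iff.1 h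
    exact not_latent_adj_none _ h
  · obtain ⟨_ | w, hvw, hwv⟩ := Relation.TransGen.head'_iff.1 h
    · exact not_latent_adj_none _ hvw
    · have hwv : some v ∈ some '' postStar G w := postStar_latent_some w ▸ hwv
      rw [Function.Injective.mem_set_image (Option.some_injective V)] at hwv
      exact hG v (.head' hvw hwv)

theorem close_adj_iff {u v : V} (h : G.Adj u v ∨ G.Adj v u) : (close G).Adj u v ↔ G.Adj u v :=
  or_iff_left fun ⟨hu, hv, _⟩ => h.elim (not_adj_of_mem_init hv) (not_adj_of_mem_init hu)

theorem postStar_subset_postStar_close (u : V) : postStar G u ⊆ postStar (close G) u :=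
  fun _ h => Relation.ReflTransGen.mono (fun _ _ => .inl) _ _ h

theorem BlockedAt.latent_of_close {u w v : V} (h : BlockedAt (close G) Z u w v)
    (huw : G.Adj u w ∨ G.Adj w u) (hwv : G.Adj w v ∨ G.Adj v w) :
    BlockedAt (latent G) (some '' Z) (some u) (some w) (some v) := by
  unfold BlockedAt at h
  rw [close_adj_iff huw, close_adj_iff huw.symm, close_adj_iff hwv, close_adj_iff hwv.symm] at h
  refine h.imp (fun ⟨hadj, hw⟩ => ⟨hadj, w, hw, rfl⟩) fun ⟨hadj, he⟩ => ⟨hadj, ?_⟩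
  rw [postStar_latent_some, ← Set.image_inter (Option.some_injective V), Set.image_eq_empty]
  exact Set.subset_empty_iff.1
    (he ▸ Set.inter_subset_inter_left Z (postStar_subset_postStar_close w))

theorem adj_of_mem_init {u v : V} (hu : u ∈ init G) (h : G.Adj u v ∨ G.Adj v u) : G.Adj u v :=
  h.resolve_right (not_adj_of_mem_init hu)

theorem BlockedAt.latent_of_mem_init {u w v : V} (h : BlockedAt (close G) Z u w v)
    (hw : w ∈ init G) (hwv : G.Adj w v) :
    BlockedAt (latent G) (some '' Z) none (some w) (some v) := by
  rcases h with ⟨-, hwZ⟩ | ⟨⟨-, hvw⟩, -⟩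
  · exact blockedAt_of_adj_right ⟨w, hwZ, rfl⟩ (.inl hw) hwv
  · exact (not_adj_of_mem_init hw ((close_adj_iff (.inr hwv)).1 hvw)).elim

namespace IsOpenTrail

theorem not_blockedAt_close {u w : V} : ∀ {p : List (Option V)},
    IsOpenTrail (latent G) (some '' Z) (some u :: some w :: p) →
    ∀ v ∈ p.reduceOption.head?, ¬ BlockedAt (close G) Z u w v
  | [], _ => by simp
  | some v :: p, h => by
    rintro v' ⟨⟩ hb
    exact h.not_blockedAt_head (hb.latent_of_close h.adj h.tail.adj)
  | none :: p, h => by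
    intro v _ hb
    have hw : w ∈ init G := h.tail.adj.resolve_left (not_latent_adj_none _)
    have hwu : G.Adj w u := adj_of_mem_init hw h.adj.symm
    exact h.not_blockedAt_head (hb.symm.latent_of_mem_init hw hwu).symm

-- A passage through the latent node joins two initial nodes, which are adjacent in `close G`.
theorem reduceOption : ∀ {p : List (Option V)}, p.Nodup →
    IsOpenTrail (latent G) (some '' Z) p → IsOpenTrail (close G) Z p.reduceOption
  | [], _, _ => .nil
  | none :: p, hnd, h => by
    rw [List.reduceOption_cons_of_none]
    exact h.tail.reduceOption hnd.of_cons
  | [some u], _, _ => .singleton u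
  | [some u, none], _, _ => .singleton u
  | some u :: some w :: p, hnd, h => by
    have ih := h.tail.reduceOption hnd.of_cons
    simp only [List.reduceOption_cons_of_some] at ih ⊢
    exact ih.cons (h.adj.imp .inl .inl) (not_blockedAt_close h)
  | some u :: none :: some w :: p, hnd, h => by
    have ih := h.tail.tail.reduceOption hnd.of_cons.of_cons
    have hu : u ∈ init G := h.adj.resolve_left (not_latent_adj_none _)
    have hw : w ∈ init G := h.tail.adj.resolve_right (not_latent_adj_none _)
    have huw : u ≠ w := by rintro rfl; simp at hnd
    simp only [List.reduceOption_cons_of_some, List.reduceOption_cons_of_none] at ih ⊢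
    refine ih.cons (.inl (.inr ⟨hu, hw, huw⟩)) fun v hv hb => ?_
    match p, hnd, h, hv with
    | some v :: p, _, h, rfl =>
      exact h.tail.not_blockedAt_head
        (hb.latent_of_mem_init hw (adj_of_mem_init hw h.tail.tail.adj))
    | none :: p, hnd, _, _ => simp at hnd
  | some u :: none :: none :: p, hnd, _ => by simp at hnd

end IsOpenTrail

theorem dSep_latent (h : (X, Y, Z) ∈ dSep (close G)) :
    (some '' X, some '' Y, some '' Z) ∈ dSep (latent G) := by
  rintro _ ⟨x, hx, rfl⟩ _ ⟨y, hy, rfl⟩ p ⟨hnd, hp, hhead, hlast⟩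
  by_contra hopen
  have hq : IsOpenTrail (close G) Z p.reduceOption := IsOpenTrail.reduceOption hnd ⟨hp, hopen⟩
  have hqnd : p.reduceOption.Nodup := hnd.filterMap fun _ _ _ h h' => h.trans h'.symm
  refine hq.2 (h x hx y hy p.reduceOption ⟨hqnd, hq.1, ?_, ?_⟩)
  · obtain ⟨p, rfl⟩ := List.head?_eq_some_iff.1 hhead
    simp
  · obtain ⟨p, rfl⟩ := List.getLast?_eq_some_iff.1 hlast
    rw [← List.concat_eq_append, List.reduceOption_concat_of_some, List.concat_eq_append,
      List.getLast?_concat]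

theorem OneSided.preimage {α β : Type*} {f : α → β} {C S : Set β} {Z : Set α} (hf : f.Injective)
    (h : OneSided C (f '' Z) S) : OneSided (f ⁻¹' C) Z (f ⁻¹' S) := by
  rintro ⟨s, hs, hsC⟩ t ht
  simpa [hf.mem_set_image] using h ⟨f s, hs, hsC⟩ ht

theorem mem_ancestors_latent {n : V} (hn : n ∈ ancestors G Z) :
    some n ∈ ancestors (latent G) (some '' Z) := by
  rw [ancestors, Set.mem_ofPred_eq, postStar_latent_some,
    ← Set.image_inter (Option.some_injective V)]
  exact hn.image some

theorem exists_separating_set (hG : Acyclic G) (hsep : (X, Y, Z) ∈ dSep (close G))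
    (hYZ : Disjoint Y Z) :
    ∃ C : Set V, Disjoint X C ∧ Y ⊆ C ∧ Disjoint Z C ∧ OneSided C Z (init G) ∧
      ∀ n ∈ ancestors G (X ∪ Y ∪ Z), OneSided C Z (insert n (pre G n)) := by
  have hsome : (some : V → Option V).Injective := Option.some_injective V
  have hL := acyclic_latent hG
  have hsepL := dSep_latent hsep
  refine ⟨some ⁻¹' dSide (latent G) (some '' Z) (some '' Y), ?_, ?_, ?_, ?_, fun n hn => ?_⟩
  · exact Set.disjoint_left.2 fun x hx hxC => not_dConnected_of_dSep hL hsepL ⟨x, hx, rfl⟩ hxC.2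
  · exact fun y hy => ⟨fun hyZ => Set.disjoint_left.1 hYZ hy ((hsome.mem_set_image).1 hyZ),
      dConnected_of_mem ⟨y, hy, rfl⟩⟩
  · exact Set.disjoint_left.2 fun z hz hzC => hzC.1 ⟨z, hz, rfl⟩
  · rw [← preimage_some_setOf_pre_latent]
    exact (oneSided_setOf_pre_eq_singleton hL (by simp)).preimage hsome
  · have hn' : some n ∈ ancestors (latent G) (some '' X ∪ some '' Y ∪ some '' Z) := by
      simpa only [Set.image_union] using mem_ancestors_latent hn
    rw [← preimage_some_insert_pre_latent]
    exact (oneSided_family hL hsepL hn').preimage hsome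

end Latent

/-! ### Factorizations along a cut -/

section Factorization

open scoped Classical

variable {V : Type*}

theorem restr_congr {U : Set V} {b b' : Asg V} (h : ∀ v ∈ U, b v = b' v) :
    restr U b = restr U b' :=
  funext fun v => h v v.2

theorem mem_cyl {U : Set V} {d : Asg U} {b : Asg V} : b ∈ cyl d ↔ ∀ v : U, b v = d v :=
  funext_iff

theorem dependsOn_mem_cyl {U : Set V} (d : Asg U) : DependsOn (· ∈ cyl d) U :=
  fun _ _ h => congrArg (· = d) (restr_congr h)

theorem dependsOn_mem_inter {T : Set V} {φ ψ : Set (Asg V)} (hφ : DependsOn (· ∈ φ) T)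
    (hψ : DependsOn (· ∈ ψ) T) : DependsOn (· ∈ φ ∩ ψ) T :=
  fun _ _ h => congrArg₂ And (hφ h) (hψ h)

theorem dependsOn_prod {ι : Type*} {s : Finset ι} {f : ι → Asg V → ℝ} {T : Set V}
    (h : ∀ i ∈ s, DependsOn (f i) T) : DependsOn (fun b => ∏ i ∈ s, f i b) T :=
  fun _ _ hb => Finset.prod_congr rfl fun i hi => h i hi hb

theorem exists_split_prod {ι : Type*} {s : Finset ι} {f : ι → Asg V → ℝ} {S : ι → Set V}
    {C Z : Set V} (hf : ∀ i, DependsOn (f i) (S i)) (hS : ∀ i ∈ s, OneSided C Z (S i)) :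
    ∃ Φ Ψ : Asg V → ℝ, DependsOn Φ (C ∪ Z) ∧ DependsOn Ψ Cᶜ ∧
      (fun b => ∏ i ∈ s, f i b) = Φ * Ψ := by
  refine ⟨fun b => ∏ i ∈ s with (S i ∩ C).Nonempty, f i b,
    fun b => ∏ i ∈ s with ¬ (S i ∩ C).Nonempty, f i b,
    dependsOn_prod fun i hi => ?_, dependsOn_prod fun i hi => ?_,
    funext fun b => (Finset.prod_filter_mul_prod_filter_not s _ _).symm⟩
  · obtain ⟨hi, hne⟩ := Finset.mem_filter.1 hi
    exact (hf i).mono (hS i hi hne)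
  · have hempty : S i ∩ C = ∅ := Set.not_nonempty_iff_eq_empty.1 (Finset.mem_filter.1 hi).2
    exact (hf i).mono (Set.disjoint_iff_inter_eq_empty.2 hempty).subset_compl_right

/-- Exchanges the values of two assignments on `C`. -/
noncomputable def swapOn (C : Set V) : Equiv.Perm (Asg V × Asg V) :=
  Function.Involutive.toPerm (fun p => (C.piecewise p.2 p.1, C.piecewise p.1 p.2)) fun p => by
    ext v <;> by_cases hv : v ∈ C <;> simp [hv]

variable {C : Set V} {v : V}

theorem swapOn_fst_of_mem (hv : v ∈ C) (p : Asg V × Asg V) : (swapOn C p).1 v = p.2 v :=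
  Set.piecewise_eq_of_mem C _ _ hv

theorem swapOn_snd_of_mem (hv : v ∈ C) (p : Asg V × Asg V) : (swapOn C p).2 v = p.1 v :=
  Set.piecewise_eq_of_mem C _ _ hv

theorem swapOn_fst_of_notMem (hv : v ∉ C) (p : Asg V × Asg V) : (swapOn C p).1 v = p.1 v :=
  Set.piecewise_eq_of_notMem C _ _ hv

theorem swapOn_snd_of_notMem (hv : v ∉ C) (p : Asg V × Asg V) : (swapOn C p).2 v = p.2 v :=
  Set.piecewise_eq_of_notMem C _ _ hv

theorem split_mul_split_swapOn {Z : Set V} {Φ Ψ : Asg V → ℝ} (hΦ : DependsOn Φ (C ∪ Z))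
    (hΨ : DependsOn Ψ Cᶜ) (hZ : Disjoint Z C) {p : Asg V × Asg V}
    (hp : ∀ v ∈ Z, p.1 v = p.2 v) :
    (Φ * Ψ) (swapOn C p).1 * (Φ * Ψ) (swapOn C p).2 = (Φ * Ψ) p.1 * (Φ * Ψ) p.2 := by
  have hZC : ∀ v ∈ Z, v ∉ C := fun _ hv => Set.disjoint_left.1 hZ hv
  have hΦ₁ : Φ (swapOn C p).1 = Φ p.2 := hΦ fun v hv => hv.elim
    (fun hvC => swapOn_fst_of_mem hvC p)
    fun hvZ => (swapOn_fst_of_notMem (hZC v hvZ) p).trans (hp v hvZ)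
  have hΦ₂ : Φ (swapOn C p).2 = Φ p.1 := hΦ fun v hv => hv.elim
    (fun hvC => swapOn_snd_of_mem hvC p)
    fun hvZ => (swapOn_snd_of_notMem (hZC v hvZ) p).trans (hp v hvZ).symm
  have hΨ₁ : Ψ (swapOn C p).1 = Ψ p.1 := hΨ fun v hv => swapOn_fst_of_notMem hv p
  have hΨ₂ : Ψ (swapOn C p).2 = Ψ p.2 := hΨ fun v hv => swapOn_snd_of_notMem hv p
  simp only [Pi.mul_apply, hΦ₁, hΦ₂, hΨ₁, hΨ₂]
  ring

theorem swapOn_mem_cyl_iff {X Y Z : Set V} (hX : Disjoint X C) (hY : Y ⊆ C) (hZ : Disjoint Z C)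
    {a : Asg X} {b : Asg Y} {c : Asg Z} (p : Asg V × Asg V) :
    (p.1 ∈ cyl a ∩ (cyl b ∩ cyl c) ∧ p.2 ∈ cyl c) ↔
      ((swapOn C p).1 ∈ cyl a ∩ cyl c ∧ (swapOn C p).2 ∈ cyl b ∩ cyl c) := by
  have hX' : ∀ v : X, v.1 ∉ C := fun v => Set.disjoint_left.1 hX v.2
  have hZ' : ∀ v : Z, v.1 ∉ C := fun v => Set.disjoint_left.1 hZ v.2
  have hY' : ∀ v : Y, v.1 ∈ C := fun v => hY v.2
  simp only [Set.mem_inter_iff, mem_cyl, swapOn_fst_of_notMem (hX' _),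
    swapOn_fst_of_notMem (hZ' _), swapOn_snd_of_notMem (hZ' _), swapOn_snd_of_mem (hY' _)]
  tauto

variable [Fintype V]

/-- The total weight of a set of assignments under an unnormalized weight function. -/
noncomputable def mass (f : Asg V → ℝ) (φ : Set (Asg V)) : ℝ :=
  ∑ b with b ∈ φ, f b

theorem mass_eq_sum_indicator (f : Asg V → ℝ) (φ : Set (Asg V)) :
    mass f φ = ∑ b, φ.indicator f b := by
  simp only [mass, Finset.sum_filter, Set.indicator_apply]

theorem mass_mul_mass_of_split {X Y Z : Set V} (hX : Disjoint X C) (hY : Y ⊆ C)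
    (hZ : Disjoint Z C) {Φ Ψ : Asg V → ℝ} (hΦ : DependsOn Φ (C ∪ Z)) (hΨ : DependsOn Ψ Cᶜ)
    (a : Asg X) (b : Asg Y) (c : Asg Z) :
    mass (Φ * Ψ) (cyl a ∩ (cyl b ∩ cyl c)) * mass (Φ * Ψ) (cyl c) =
      mass (Φ * Ψ) (cyl a ∩ cyl c) * mass (Φ * Ψ) (cyl b ∩ cyl c) := by
  simp only [mass, Finset.sum_mul_sum, ← Finset.sum_product']
  refine Finset.sum_equiv (swapOn C) (fun p => ?_) fun p hp => ?_
  · simpa using swapOn_mem_cyl_iff hX hY hZ p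
  · have hp' : p.1 ∈ cyl a ∩ (cyl b ∩ cyl c) ∧ p.2 ∈ cyl c := by simpa using hp
    refine (split_mul_split_swapOn hΦ hΨ hZ fun v hv => ?_).symm
    exact (mem_cyl.1 hp'.1.2.2 ⟨v, hv⟩).trans (mem_cyl.1 hp'.2 ⟨v, hv⟩).symm

end Factorization

/-! ### The factors of a network -/

section Factors

open scoped Classical

variable {V : Type*} [Fintype V]

/-- The factors of the chain rule: `none` stands for the joint distribution of the initial nodes,
`some X` for the table of the non-initial node `X`. -/
noncomputable def factor (B : GBN V) : Option {X : V // X ∉ init B.graph} → Asg V → ℝ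
  | none => fun b => B.iota (restr (init B.graph) b)
  | some X => fun b => B.cpt X.1 X.2 (restr (pre B.graph X.1) b) (restr ({X.1} : Set V) b)

/-- The variables on which a factor of the chain rule depends. -/
def scope (B : GBN V) : Option {X : V // X ∉ init B.graph} → Set V
  | none => init B.graph
  | some X => insert X.1 (pre B.graph X.1)

theorem dependsOn_factor (B : GBN V) (k) : DependsOn (factor B k) (scope B k) := by
  intro b b' h
  match k with
  | none => exact congrArg B.iota (restr_congr h)
  | some X =>
    have hpre : restr (pre B.graph X) b = restr (pre B.graph X) b' :=
      restr_congr fun v hv => h v (.inr hv)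
    have hX : restr {X.1} b = restr {X.1} b' := restr_congr fun v hv => h v (.inl hv)
    simp only [factor, hpre, hX]

theorem factor_update_add_factor_update (B : GBN V) (hB : Acyclic B.graph)
    (X : {X : V // X ∉ init B.graph}) (b : Asg V) :
    factor B (some X) (Function.update b X true) +
      factor B (some X) (Function.update b X false) = 1 := by
  have hpre : ∀ x, restr (pre B.graph X) (Function.update b X x) = restr (pre B.graph X) b :=
    fun x => restr_congr fun v (hv : B.graph.Adj v X) =>
      Function.update_of_ne (by rintro rfl; exact hB _ (.single hv)) _ _
  have hX : ∀ x, restr {X.1} (Function.update b X x) = uniqueElim x := by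
    rintro x
    ext ⟨_, rfl⟩
    simp [restr]
  simp only [factor, hpre, hX]
  rw [← Fintype.sum_bool fun x => B.cpt X X.2 (restr (pre B.graph X) b) (uniqueElim x),
    ← (B.cpt X X.2 (restr (pre B.graph X) b)).2.2]
  exact (Equiv.funUnique ({X.1} : Set V) Bool).symm.sum_comp _

theorem two_mul_sum_mul_factor (B : GBN V) (hB : Acyclic B.graph) {X : {X : V // X ∉ init B.graph}}
    {g : Asg V → ℝ} (hg : DependsOn g {X.1}ᶜ) :
    2 * ∑ b, g b * factor B (some X) b = ∑ b, g b :=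
  two_mul_sum_mul X.1 g (factor B (some X))
    (fun _ _ => hg fun _ hv => Function.update_of_ne hv _ _)
    (factor_update_add_factor_update B hB X)

-- Each table costs a factor of two, since the sums run over full assignments.
theorem two_pow_mul_sum_mul_prod_factor (B : GBN V) (hB : Acyclic B.graph) {g : Asg V → ℝ}
    {T : Set V} (hg : DependsOn g T) {S : Finset {X : V // X ∉ init B.graph}}
    (hS : ∀ X ∈ S, X.1 ∉ T) :
    2 ^ S.card * ∑ b, g b * ∏ X ∈ S, factor B (some X) b = ∑ b, g b := by
  induction S using Finset.eraseInduction with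
  | H S ih =>
    obtain rfl | hne := S.eq_empty_or_nonempty
    · simp
    obtain ⟨X, hX, hsink⟩ := exists_sink hB S hne
    have hgX : DependsOn g {X.1}ᶜ :=
      hg.mono fun v hv hvX => hS X hX (Set.mem_singleton_iff.1 hvX ▸ hv)
    have hrest : DependsOn (fun b => ∏ Y ∈ S.erase X, factor B (some Y) b) {X.1}ᶜ := by
      refine dependsOn_prod fun Y hY => (dependsOn_factor B (some Y)).mono ?_
      obtain ⟨hYX, hY⟩ := Finset.mem_erase.1 hY
      rw [scope, Set.subset_compl_singleton_iff, Set.mem_insert_iff]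
      exact not_or.2 ⟨fun hXY => hYX (Subtype.ext hXY.symm), hsink Y hY⟩
    have hsum := two_mul_sum_mul_factor B hB fun _ _ h => congrArg₂ (· * ·) (hgX h) (hrest h)
    rw [← ih X hX fun Y hY => hS Y (Finset.mem_of_mem_erase hY), ← hsum,
      ← Finset.card_erase_add_one hX, pow_succ, mul_assoc]
    simp only [mul_assoc, Finset.prod_erase_mul S _ hX]

/-- The product of the factors of the initial nodes and of the nodes in `T`. -/
noncomputable def partialWeight (B : GBN V) (T : Set V) (b : Asg V) : ℝ :=
  ∏ k ∈ Finset.insertNone {X | X.1 ∈ T}, factor B k b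

theorem dependsOn_partialWeight (B : GBN V) {T : Set V} (hT : ∀ v ∈ T, pre B.graph v ⊆ T) :
    DependsOn (partialWeight B T) (T ∪ init B.graph) := by
  refine dependsOn_prod fun k hk => (dependsOn_factor B k).mono ?_
  match k with
  | none => exact Set.subset_union_right
  | some X =>
    have hX : X.1 ∈ T := by simpa using hk
    exact (Set.insert_subset hX (hT X hX)).trans Set.subset_union_left

theorem chainRule_eq_partialWeight_mul (B : GBN V) (T : Set V) (b : Asg V) :
    chainRule B b = partialWeight B T b * ∏ X with X.1 ∉ T, factor B (some X) b := by
  rw [partialWeight, Finset.prod_insertNone, mul_assoc, Finset.prod_filter_mul_prod_filter_not]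
  rfl

theorem two_pow_mul_prob_distBN (B : GBN V) (hB : Acyclic B.graph) {T : Set V}
    (hT : ∀ v ∈ T, pre B.graph v ⊆ T) {φ : Set (Asg V)} (hφ : DependsOn (· ∈ φ) T) :
    2 ^ Finset.card {X : {X : V // X ∉ init B.graph} | X.1 ∉ T} * prob (distBN B hB) φ =
      mass (partialWeight B T) φ := by
  have hg : DependsOn (φ.indicator (partialWeight B T)) (T ∪ init B.graph) := fun b b' h => by
    have hmem : (b ∈ φ) = (b' ∈ φ) := hφ.mono Set.subset_union_left h
    simp only [Set.indicator_apply, hmem, dependsOn_partialWeight B hT h]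
  have hprob : prob (distBN B hB) φ =
      ∑ b, φ.indicator (partialWeight B T) b * ∏ X with X.1 ∉ T, factor B (some X) b := by
    simp only [prob, Finset.sum_filter, Set.indicator_apply, ite_mul, zero_mul,
      ← chainRule_eq_partialWeight_mul]
    rfl
  rw [mass_eq_sum_indicator, hprob]
  refine two_pow_mul_sum_mul_prod_factor B hB hg fun X hX => ?_
  simpa using ⟨(Finset.mem_filter.1 hX).2, X.2⟩

/-! ### Conditional independence -/

theorem prob_nonneg (μ : Dist (Asg V)) (φ : Set (Asg V)) : 0 ≤ prob μ φ :=
  Finset.sum_nonneg fun b _ => μ.2.1 b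

theorem prob_mono (μ : Dist (Asg V)) {φ ψ : Set (Asg V)} (h : φ ⊆ ψ) : prob μ φ ≤ prob μ ψ :=
  Finset.sum_le_sum_of_subset_of_nonneg (Finset.monotone_filter_right _ fun _ _ hb => h hb)
    fun b _ _ => μ.2.1 b

theorem mem_indep_of_prob_mul_prob {μ : Dist (Asg V)} {X Y Z : Set V}
    (hdisj : (X, Y, Z) ∈ DisjointTriples V)
    (h : ∀ (a : Asg X) (b : Asg Y) (c : Asg Z),
      prob μ (cyl a ∩ (cyl b ∩ cyl c)) * prob μ (cyl c) =
        prob μ (cyl a ∩ cyl c) * prob μ (cyl b ∩ cyl c)) :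
    (X, Y, Z) ∈ Indep μ := by
  refine ⟨hdisj, fun a b c => or_iff_not_imp_right.2 fun hbc => ?_⟩
  have hc : prob μ (cyl c) ≠ 0 := fun hc =>
    hbc (le_antisymm (hc ▸ prob_mono μ Set.inter_subset_right) (prob_nonneg μ _))
  exact (div_eq_div_iff hbc hc).2 (h a b c)

theorem prob_mul_prob_of_mem_dSep (B : GBN V) (hB : Acyclic B.graph) {X Y Z : Set V}
    (hsep : (X, Y, Z) ∈ dSep (close B.graph)) (hYZ : Disjoint Y Z)
    (a : Asg X) (b : Asg Y) (c : Asg Z) :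
    prob (distBN B hB) (cyl a ∩ (cyl b ∩ cyl c)) * prob (distBN B hB) (cyl c) =
      prob (distBN B hB) (cyl a ∩ cyl c) * prob (distBN B hB) (cyl b ∩ cyl c) := by
  obtain ⟨C, hX, hY, hZ, hinit, hfam⟩ := exists_separating_set hB hsep hYZ
  set T := ancestors B.graph (X ∪ Y ∪ Z)
  have hT : ∀ v ∈ T, pre B.graph v ⊆ T := fun v hv u huv => mem_ancestors_of_adj huv hv
  obtain ⟨⟨hXT, hYT⟩, hZT⟩ : (X ⊆ T ∧ Y ⊆ T) ∧ Z ⊆ T := by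
    simpa only [Set.union_subset_iff] using subset_ancestors B.graph (X ∪ Y ∪ Z)
  have ha := (dependsOn_mem_cyl a).mono hXT
  have hb := (dependsOn_mem_cyl b).mono hYT
  have hc := (dependsOn_mem_cyl c).mono hZT
  obtain ⟨Φ, Ψ, hΦ, hΨ, hsplit⟩ := exists_split_prod (dependsOn_factor B)
    (Finset.forall_mem_insertNone.2 ⟨hinit, fun n hn => hfam n (Finset.mem_filter.1 hn).2⟩)
  have key := mass_mul_mass_of_split hX hY hZ hΦ hΨ a b c
  change partialWeight B T = Φ * Ψ at hsplit
  rw [← hsplit,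
    ← two_pow_mul_prob_distBN B hB hT (dependsOn_mem_inter ha (dependsOn_mem_inter hb hc)),
    ← two_pow_mul_prob_distBN B hB hT hc,
    ← two_pow_mul_prob_distBN B hB hT (dependsOn_mem_inter ha hc),
    ← two_pow_mul_prob_distBN B hB hT (dependsOn_mem_inter hb hc),
    mul_mul_mul_comm, mul_mul_mul_comm _ _ _ (prob _ (_ ∩ _))] at key
  exact mul_left_cancel₀ (by positivity) key

end Factors

end GenBN

theorem lemma1 {V : Type*} [Fintype V] (B : GenBN.GBN V) (hB : GenBN.Acyclic B.graph) :
    GenBN.dSep (GenBN.close B.graph) ∩ GenBN.DisjointTriples V ⊆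
      GenBN.Indep (GenBN.distBN B hB) := by
  rintro ⟨X, Y, Z⟩ ⟨hsep, hdisj⟩
  exact GenBN.mem_indep_of_prob_mul_prob hdisj
    (GenBN.prob_mul_prob_of_mem_dSep B hB hsep hdisj.2.2)
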